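/- Let $p\ge 3$ and let $n_1,\dots,n_p$ be positive integers. For $k=3,\dots,p$ let $T_k\in\mathbb{C}^{n_k\times n_k}$, and let $L$ be the transform of $\mathbb{C}^{n_1\times n_2\times\cdots\times n_p}$ given by $L(\mathcal{A})=\mathcal{A}\times_3 T_3\times_4 T_4\cdots\times_p T_p$, where $$(\mathcal{A}\times_k T)_{i_1,\dots,i_{k-1},j,i_{k+1},\dots,i_p}=\sum_{i_k=1}^{n_k}\mathcal{A}_{i_1,\dots,i_p}\,T_{j,i_k}.$$ Suppose that $L$ is unitary with respect to the inner product $\langle\mathcal{Y},\mathcal{X}\rangle=\sum_{i_1,\dots,i_p}\overline{\mathcal{Y}_{i_1,\dots,i_p}}\,\mathcal{X}_{i_1,\dots,i_p}$ (for instance, that every $T_k$ is a unitary matrix). For a multi-index $s=(i_3,\dots,i_p)$ let $L(\mathcal{X})_s\in\mathbb{C}^{n_1\times n_2}$ be the matrix slice of $L(\mathcal{X})$ obtained by fixing the last $p-2$ indices to $s$. Define the tensor nuclear norm $\|\mathcal{X}\|_{*,L}=\sum_s\|L(\mathcal{X})_s\|_*$ (the sum of all singular values of all slices), the tensor spectral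 norm $\|\mathcal{X}\|$ as the spectral norm (the largest singular value) of the block diagonal matrix with blocks $L(\mathcal{X})_s$, and the $\ell_1$ norm of the multi-rank $\Upsilon(\mathcal{X})=\sum_s\operatorname{rank}(L(\mathcal{X})_s)$. Let $C=\{\mathcal{X} : \|\mathcal{X}\|\le 1\}$. Then on $C$ the tensor nuclear norm is the convex envelope of $\Upsilon$: the function $\|\cdot\|_{*,L}$ is convex on the convex set $C$, satisfies $\|\mathcal{X}\|_{*,L}\le\Upsilon(\mathcal{X})$ for all $\mathcal{X}\in C$, and $h\le\|\cdot\|_{*,L}$ on $C$ for every convex function $h:C\to\mathbb{R}$ with $h\le\Upsilon$ on $C$. Moreover it is the biconjugate of $\Upsilon$ on $C$: with $$\Upsilon^{\#}(\mathcal{Y})=\sup_{\mathcal{X}\in C}\bigl(\operatorname{Re}\langle\mathcal{Y},\mathcal{X}\rangle-\Upsilon(\mathcal{X})\bigr),\qquad \Upsilon^{\#\#}(\mathcal{Z})=\sup_{\mathcal{Y}}\bigl(\operatorname{Re}\langle\mathcal{Z},\mathcal{Y}\rangle-\Upsilon^{\#}(\mathcal{Y})\bigr),$$ where $\mathcal{Y}$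 ranges over all of $\mathbb{C}^{n_1\times\cdots\times n_p}$, one has $\Upsilon^{\#\#}(\mathcal{Z})=\|\mathcal{Z}\|_{*,L}$ for every $\mathcal{Z}\in C$. -/

import Mathlib

noncomputable section

/-- The largest singular value of a complex matrix. -/
def matrixSpectralNorm {α β : Type*} [Fintype α] [Fintype β] [DecidableEq β]
    (M : Matrix α β ℂ) : ℝ :=
  ⨆ j : ℕ, (Matrix.toEuclideanLin M).singularValues j

/-- The sum of the singular values of a complex matrix. -/
def matrixNuclearNorm {α β : Type*} [Fintype α] [Fintype β] [DecidableEq β]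
    (M : Matrix α β ℂ) : ℝ :=
  ∑ j ∈ Finset.range (min (Fintype.card α) (Fintype.card β)),
    (Matrix.toEuclideanLin M).singularValues j

/-- `g` is the convex envelope of `f` on `C`: the largest convex function on `C` that is bounded
above by `f` on `C`. -/
def IsConvexEnvelopeOn {E : Type*} [AddCommGroup E] [Module ℝ E] (C : Set E) (f g : E → ℝ) :
    Prop :=
  ConvexOn ℝ C g ∧ (∀ x ∈ C, g x ≤ f x) ∧
    ∀ h : E → ℝ, ConvexOn ℝ C h → (∀ x ∈ C, h x ≤ f x) → ∀ x ∈ C, h x ≤ g x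

/-- Complex tensors of order `p = d + 2` and size `n₁ × n₂ × n 0 × ⋯ × n (d - 1)`. The first two
indices are kept apart from the other ones, which together form a multi-index. -/
abbrev PTensor {d : ℕ} (n₁ n₂ : ℕ) (n : Fin d → ℕ) : Type :=
  Fin n₁ → Fin n₂ → ((k : Fin d) → Fin (n k)) → ℂ

namespace PTensor

variable {d n₁ n₂ : ℕ} {n : Fin d → ℕ}

/-- The matrix slice of `A` at the multi-index `s`. -/
def slice (A : PTensor n₁ n₂ n) (s : (k : Fin d) → Fin (n k)) : Matrix (Fin n₁) (Fin n₂) ℂ :=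
  Matrix.of fun i j => A i j s

/-- `Re ⟨Y, X⟩` is the real part of this inner product, which is the sum over the slices of
`tr (Yₛᴴ Xₛ)`. -/
def innerProd (Y X : PTensor n₁ n₂ n) : ℂ :=
  ∑ i, ∑ j, ∑ s, star (Y i j s) * X i j s

/-- The product of `A` with the square matrix `X` along the mode `k` (the `(k + 3)`-rd mode of the
tensor, as `k` starts from zero). -/
def modeProduct (A : PTensor n₁ n₂ n) (k : Fin d) (X : Matrix (Fin (n k)) (Fin (n k)) ℂ) :
    PTensor n₁ n₂ n :=
  fun i j s => ∑ a : Fin (n k), A i j (Function.update s k a) * X (s k) a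

/-- The transform `L(A) = A ×₃ T₃ ×₄ T₄ ⋯ ×ₚ Tₚ`. -/
def transform (T : (k : Fin d) → Matrix (Fin (n k)) (Fin (n k)) ℂ) (A : PTensor n₁ n₂ n) :
    PTensor n₁ n₂ n :=
  (List.finRange d).foldl (fun B k => modeProduct B k (T k)) A

/-- A map of the tensor space to itself is unitary if it is linear, bijective and preserves the
inner product. -/
structure IsUnitaryMap (L : PTensor n₁ n₂ n → PTensor n₁ n₂ n) : Prop where
  isLinear : IsLinearMap ℂ L
  bijective : Function.Bijective L
  inner_eq : ∀ Y X : PTensor n₁ n₂ n, innerProd (L Y) (L X) = innerProd Y X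

/-- The tensor spectral norm: the spectral norm of the block diagonal matrix whose blocks are the
slices of `L(A)`. -/
def spectralNorm (L : PTensor n₁ n₂ n → PTensor n₁ n₂ n) (A : PTensor n₁ n₂ n) : ℝ :=
  matrixSpectralNorm (Matrix.blockDiagonal (slice (L A)))

/-- The tensor nuclear norm. -/
def nuclearNorm (L : PTensor n₁ n₂ n → PTensor n₁ n₂ n) (A : PTensor n₁ n₂ n) : ℝ :=
  ∑ s, matrixNuclearNorm (slice (L A) s)

/-- The multi-rank: the vector of the ranks of the slices of `L(A)`. -/
def multiRank (L : PTensor n₁ n₂ n → PTensor n₁ n₂ n) (A : PTensor n₁ n₂ n) :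
    ((k : Fin d) → Fin (n k)) → ℕ :=
  fun s => (slice (L A) s).rank

/-- The `ℓ₁` norm of the multi-rank. -/
def multiRankL1 (L : PTensor n₁ n₂ n → PTensor n₁ n₂ n) (A : PTensor n₁ n₂ n) : ℝ :=
  ∑ s, |(multiRank L A s : ℝ)|

/-- The unit ball of the tensor spectral norm. -/
def spectralBall (L : PTensor n₁ n₂ n → PTensor n₁ n₂ n) : Set (PTensor n₁ n₂ n) :=
  {X | spectralNorm L X ≤ 1}

/-- The conjugate `Y ↦ sup_{X ∈ C} (Re ⟨Y, X⟩ - F X)` of `F` on the set `C`. -/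
def conjugateOn (C : Set (PTensor n₁ n₂ n)) (F : PTensor n₁ n₂ n → EReal)
    (Y : PTensor n₁ n₂ n) : EReal :=
  ⨆ X ∈ C, (((innerProd Y X).re : ℝ) : EReal) - F X

/-- The biconjugate of a real function `f` on the set `C`: the conjugate (on the whole space) of
the conjugate of `f` on `C`. -/
def biconjugateOn (C : Set (PTensor n₁ n₂ n)) (f : PTensor n₁ n₂ n → ℝ) :
    PTensor n₁ n₂ n → EReal :=
  conjugateOn Set.univ (conjugateOn C fun X => (f X : EReal))

end PTensor

end

/-!
The proof works with the singular values of all slices of `L X` at once. The singular value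
decompositions `L(X)ₛ = ∑ⱼ σₛⱼ uₛⱼ vₛⱼᴴ` give a real-linear family `A t` of tensors with
`L(A t)ₛ = ∑ⱼ tₛⱼ uₛⱼ vₛⱼᴴ` (`PTensor.IsUnitaryMap.exists_svd_family`) such that `X = A σ`. For `t`
in the unit cube `A t` lies in the spectral unit ball `C`, and at a vertex `t` of the cube the
total rank of `A t` is at most `∑ t`.

*Largest convex minorant.* If `h` is convex on `C` and at most the total rank, then `h ∘ A` is
convex on the cube and at most `∑ t` at its vertices, hence on all of the cube
(`ConvexOn.le_sum_of_le_sum_vertices`). At `t = σ` this says `h X ≤ ∑ σ`, the nuclear norm of `X`.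
Conversely the nuclear norm is at most the total rank on `C`, because each singular value is
at most `1` and exactly the nonzero ones are counted by the rank.

*Convexity.* Computing the trace in a basis of right singular vectors gives
`Re ⟨Y, X⟩ ≤ ‖X‖_{*,L}` for all `Y ∈ C`, with equality at `Y = A 1`, whose transform consists of
the polar factors of the slices. Thus the nuclear norm is a maximum of linear functionals. That
`L` preserves the inner product matters only for this duality.

*Biconjugate.* For each `Y` the function `X ↦ Re ⟨Y, X⟩ - Υ#(Y)` is an affine minorant of the total
rank on `C`, so the nuclear norm dominates it, and `Υ## ≤ ‖·‖_{*,L}`. For `Y ∈ C` the conjugate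
vanishes, since `Re ⟨Y, X⟩ ≤ ‖X‖_{*,L} ≤ Υ(X)` with equality at `X = 0`; taking for `Y` the tensor
that attains the duality for `Z` gives `Υ##(Z) ≥ Re ⟨Z, Y⟩ = ‖Z‖_{*,L}`.
-/

open scoped InnerProductSpace

/-! ### Singular value decomposition of a linear map -/

section Operators

variable {ι E F : Type*} [Fintype ι] [NormedAddCommGroup E] [InnerProductSpace ℂ E]
  [NormedAddCommGroup F] [InnerProductSpace ℂ F]

/-- Pythagoras: `T w` is an orthogonal sum of multiples of the `T (b j)`. -/
theorem LinearMap.norm_sq_apply_of_orthogonal (T : E →ₗ[ℂ] F) (b : OrthonormalBasis ι ℂ E)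
    (h : ∀ i j, i ≠ j → ⟪T (b i), T (b j)⟫_ℂ = 0) (w : E) :
    ‖T w‖ ^ 2 = ∑ j, ‖⟪b j, w⟫_ℂ‖ ^ 2 * ‖T (b j)‖ ^ 2 := by
  have hw : T w = ∑ j, ⟪b j, w⟫_ℂ • T (b j) := by
    conv_lhs => rw [← b.sum_repr' w]
    simp
  have hc : ((‖T w‖ ^ 2 : ℝ) : ℂ) =
      ((∑ j, ‖⟪b j, w⟫_ℂ‖ ^ 2 * ‖T (b j)‖ ^ 2 : ℝ) : ℂ) := by
    have h1 : ((‖T w‖ ^ 2 : ℝ) : ℂ) = ⟪T w, T w⟫_ℂ := by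
      rw [inner_self_eq_norm_sq_to_K]; norm_cast
    rw [h1, hw, sum_inner, Complex.ofReal_sum]
    refine Finset.sum_congr rfl fun i _ => ?_
    rw [inner_sum, Finset.sum_eq_single i]
    · rw [inner_smul_left, inner_smul_right, inner_self_eq_norm_sq_to_K, ← mul_assoc,
        Complex.conj_mul']
      push_cast; rfl
    · intro j _ hj
      rw [inner_smul_left, inner_smul_right, h i j hj.symm, mul_zero, mul_zero]
    · simp
  exact_mod_cast hc

theorem LinearMap.norm_apply_le_of_orthogonal (T : E →ₗ[ℂ] F) (b : OrthonormalBasis ι ℂ E)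
    (h : ∀ i j, i ≠ j → ⟪T (b i), T (b j)⟫_ℂ = 0) (h1 : ∀ j, ‖T (b j)‖ ≤ 1) (w : E) :
    ‖T w‖ ≤ ‖w‖ := by
  refine le_of_sq_le_sq ?_ (norm_nonneg _)
  rw [T.norm_sq_apply_of_orthogonal b h w, ← b.sum_sq_norm_inner_right w]
  refine Finset.sum_le_sum fun j _ => mul_le_of_le_one_right (by positivity) ?_
  exact pow_le_one₀ (norm_nonneg _) (h1 j)

variable [FiniteDimensional ℂ E] [FiniteDimensional ℂ F]

/-- A basis of right singular vectors: it is orthonormal, its images under `T` are pairwise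
orthogonal, and their norms are the singular values of `T`. -/
theorem LinearMap.exists_orthonormalBasis_singularValues (T : E →ₗ[ℂ] F) {m : ℕ}
    (hm : Module.finrank ℂ E = m) :
    ∃ v : OrthonormalBasis (Fin m) ℂ E,
      (∀ i j, i ≠ j → ⟪T (v i), T (v j)⟫_ℂ = 0) ∧ ∀ j : Fin m, ‖T (v j)‖ = T.singularValues j := by
  let v := T.isSymmetric_adjoint_comp_self.eigenvectorBasis hm
  have key (i j : Fin m) : ⟪T (v i), T (v j)⟫_ℂ =
      (T.isSymmetric_adjoint_comp_self.eigenvalues hm j : ℂ) * ⟪v i, v j⟫_ℂ := by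
    rw [← LinearMap.adjoint_inner_right, ← LinearMap.comp_apply,
      T.isSymmetric_adjoint_comp_self.apply_eigenvectorBasis hm j, inner_smul_right]
    rfl
  refine ⟨v, fun i j hij => ?_, fun j => ?_⟩
  · rw [key, v.inner_eq_zero hij, mul_zero]
  · have h2 : ‖T (v j)‖ ^ 2 = T.singularValues j ^ 2 := by
      have := key j j
      rw [inner_self_eq_norm_sq_to_K, inner_self_eq_norm_sq_to_K, v.norm_eq_one] at this
      rw [T.sq_singularValues_fin hm]
      have h3 : ((‖T (v j)‖ ^ 2 : ℝ) : ℂ) =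
          ((T.isSymmetric_adjoint_comp_self.eigenvalues hm j : ℝ) : ℂ) := by
        simpa using this
      exact Complex.ofReal_injective h3
    exact (sq_eq_sq₀ (norm_nonneg _) (T.singularValues_nonneg _)).1 h2

theorem LinearMap.bddAbove_range_singularValues (T : E →ₗ[ℂ] F) :
    BddAbove (Set.range T.singularValues) :=
  ⟨T.singularValues 0, by rintro _ ⟨j, rfl⟩; exact T.singularValues_antitone (Nat.zero_le j)⟩

/-- The largest singular value is at most `1` exactly for a contraction. -/
theorem LinearMap.iSup_singularValues_le_one_iff (T : E →ₗ[ℂ] F) :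
    ⨆ j, T.singularValues j ≤ 1 ↔ ∀ w, ‖T w‖ ≤ ‖w‖ := by
  obtain ⟨v, hv, hn⟩ := T.exists_orthonormalBasis_singularValues rfl
  constructor
  · intro h
    refine T.norm_apply_le_of_orthogonal v hv fun j => ?_
    rw [hn]
    exact (le_ciSup T.bddAbove_range_singularValues _).trans h
  · intro h
    refine ciSup_le fun j => ?_
    rcases lt_or_ge j (Module.finrank ℂ E) with hj | hj
    · simpa [v.norm_eq_one] using (hn ⟨j, hj⟩).symm.le.trans (h _)
    · rw [T.singularValues_of_finrank_le hj]
      exact zero_le_one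

theorem LinearMap.singularValues_le_one {T : E →ₗ[ℂ] F} (hT : ∀ w, ‖T w‖ ≤ ‖w‖) (j : ℕ) :
    T.singularValues j ≤ 1 :=
  (le_ciSup T.bddAbove_range_singularValues j).trans (T.iSup_singularValues_le_one_iff.2 hT)

theorem LinearMap.trace_adjoint_comp (S T : E →ₗ[ℂ] F) (b : OrthonormalBasis ι ℂ E) :
    (adjoint S ∘ₗ T).trace ℂ E = ∑ j, ⟪S (b j), T (b j)⟫_ℂ := by
  rw [LinearMap.trace_eq_sum_inner _ b]
  simp [LinearMap.adjoint_inner_right]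

/-- One half of the duality between the spectral and the nuclear norm. -/
theorem LinearMap.re_trace_adjoint_comp_le (S T : E →ₗ[ℂ] F) (hS : ∀ w, ‖S w‖ ≤ ‖w‖) :
    ((adjoint S ∘ₗ T).trace ℂ E).re ≤
      ∑ j : Fin (Module.finrank ℂ E), T.singularValues j := by
  obtain ⟨v, -, hn⟩ := T.exists_orthonormalBasis_singularValues rfl
  rw [S.trace_adjoint_comp T v, Complex.re_sum]
  refine Finset.sum_le_sum fun j _ => ?_
  calc (⟪S (v j), T (v j)⟫_ℂ).re ≤ ‖S (v j)‖ * ‖T (v j)‖ :=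
        (Complex.re_le_norm _).trans (norm_inner_le_norm _ _)
    _ ≤ 1 * ‖T (v j)‖ := by
        gcongr
        simpa [v.norm_eq_one] using hS (v j)
    _ = T.singularValues j := by rw [one_mul, hn]

/-- The singular value decomposition, as a real-linear family `D t = ∑ⱼ tⱼ uⱼ vⱼᴴ` that replaces
the singular values of `T` by arbitrary real numbers. Here `D 1` is the partial isometry
of the polar decomposition of `T`, for which the duality of the spectral and the nuclear norm is
attained. -/
theorem LinearMap.exists_svd_family (T : E →ₗ[ℂ] F) {m : ℕ} (hm : Module.finrank ℂ E = m) :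
    ∃ D : (Fin m → ℝ) →ₗ[ℝ] E →ₗ[ℂ] F,
      D (fun j => T.singularValues j) = T ∧
      (∀ t, (∀ j, t j ∈ Set.Icc (0 : ℝ) 1) → ∀ w, ‖D t w‖ ≤ ‖w‖) ∧
      (∀ t, (∀ j, t j ∈ ({0, 1} : Set ℝ)) → (Module.finrank ℂ (D t).range : ℝ) ≤ ∑ j, t j) ∧
      ((adjoint (D 1) ∘ₗ T).trace ℂ E).re = ∑ j : Fin m, T.singularValues j := by
  obtain ⟨v, hv, hn⟩ := T.exists_orthonormalBasis_singularValues hm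
  -- For a zero singular value the inverse is zero, so that the left singular vector is zero.
  let u : Fin m → F := fun j => (((T.singularValues j)⁻¹ : ℝ) : ℂ) • T (v j)
  have hu (i j) (hij : i ≠ j) : ⟪u i, u j⟫_ℂ = 0 := by
    simp only [u, inner_smul_left, inner_smul_right, hv i j hij, mul_zero]
  have hu1 (j : Fin m) : ‖u j‖ ≤ 1 := by
    simp only [u, norm_smul, hn, Complex.norm_real, norm_inv,
      Real.norm_of_nonneg (T.singularValues_nonneg _)]
    exact inv_mul_le_one
  have huT (j : Fin m) : ((T.singularValues j : ℝ) : ℂ) • u j = T (v j) := by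
    by_cases h : T.singularValues j = 0
    · have : T (v j) = 0 := by rw [← norm_eq_zero, hn, h]
      simp [this, h]
    · simp only [u, smul_smul, ← Complex.ofReal_mul, mul_inv_cancel₀ h, Complex.ofReal_one,
        one_smul]
  let D₀ (t : Fin m → ℝ) : E →ₗ[ℂ] F := v.toBasis.constr ℂ fun j => (t j : ℂ) • u j
  have hD₀ (t j) : D₀ t (v j) = (t j : ℂ) • u j := by
    have := v.toBasis.constr_basis ℂ (fun j => (t j : ℂ) • u j) j
    rwa [OrthonormalBasis.coe_toBasis] at this
  let D : (Fin m → ℝ) →ₗ[ℝ] E →ₗ[ℂ] F :=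
    { toFun := D₀
      map_add' := fun s t => v.toBasis.ext fun j => by
        rw [OrthonormalBasis.coe_toBasis, LinearMap.add_apply, hD₀, hD₀, hD₀, ← add_smul]
        simp
      map_smul' := fun c t => v.toBasis.ext fun j => by
        rw [OrthonormalBasis.coe_toBasis, LinearMap.smul_apply, hD₀, hD₀]
        simp [mul_smul] }
  have hD (t j) : D t (v j) = (t j : ℂ) • u j := hD₀ t j
  refine ⟨D, v.toBasis.ext fun j => ?_, fun t ht w => ?_, fun t ht => ?_, ?_⟩
  · rw [OrthonormalBasis.coe_toBasis, hD, huT]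
  · refine (D t).norm_apply_le_of_orthogonal v (fun i j hij => ?_) (fun j => ?_) w
    · rw [hD, hD, inner_smul_left, inner_smul_right, hu i j hij, mul_zero, mul_zero]
    · rw [hD, norm_smul, Complex.norm_real, Real.norm_of_nonneg (ht j).1]
      exact mul_le_one₀ (ht j).2 (norm_nonneg _) (hu1 j)
  · classical
    have hle : (D t).range ≤
        Submodule.span ℂ (((Finset.univ.filter fun j => t j = 1).image u : Finset F) : Set F) := by
      rintro _ ⟨w, rfl⟩
      rw [← v.sum_repr' w, map_sum]
      refine Submodule.sum_mem _ fun j _ => ?_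
      rw [map_smul, hD]
      refine Submodule.smul_mem _ _ ?_
      rcases ht j with h | h
      · simp [h]
      · refine Submodule.smul_mem _ _ (Submodule.subset_span ?_)
        simpa using ⟨j, h, rfl⟩
    have hcard : ((Finset.univ.filter fun j => t j = 1).card : ℝ) = ∑ j, t j := by
      rw [Finset.card_filter, Nat.cast_sum]
      refine Finset.sum_congr rfl fun j _ => ?_
      rcases ht j with h | h <;> simp [show t j = _ from h]
    rw [← hcard, Nat.cast_le]
    exact (Submodule.finrank_mono hle).trans
      ((finrank_span_finset_le_card _).trans Finset.card_image_le)
  · rw [(D 1).trace_adjoint_comp T v, Complex.re_sum]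
    refine Finset.sum_congr rfl fun j => ?_
    intro _
    rw [hD]
    simp only [Pi.one_apply, Complex.ofReal_one, one_smul, u, inner_smul_left,
      inner_self_eq_norm_sq_to_K, hn, Complex.conj_ofReal]
    by_cases h : T.singularValues j = 0
    · simp [h]
    · have : (((T.singularValues j)⁻¹ : ℝ) : ℂ) * ((T.singularValues j : ℝ) : ℂ) ^ 2 =
          ((T.singularValues j : ℝ) : ℂ) := by
        norm_cast; field_simp
      exact (congrArg Complex.re this).trans (Complex.ofReal_re _)

end Operators

/-! ### Convex functions on a cube -/

/-- On the unit cube, a convex function that is at most the sum of the coordinates at every vertex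
is so everywhere: subtracting the sum leaves a convex function, whose maximum lies at a vertex. -/
theorem ConvexOn.le_sum_of_le_sum_vertices {ι : Type*} [Fintype ι] {φ : (ι → ℝ) → ℝ}
    (hφ : ConvexOn ℝ (Set.univ.pi fun _ => Set.Icc (0 : ℝ) 1) φ)
    (hv : ∀ t, (∀ j, t j ∈ ({0, 1} : Set ℝ)) → φ t ≤ ∑ j, t j) {t : ι → ℝ}
    (ht : ∀ j, t j ∈ Set.Icc (0 : ℝ) 1) : φ t ≤ ∑ j, t j := by
  have hlin : ConcaveOn ℝ (Set.univ.pi fun _ => Set.Icc (0 : ℝ) 1)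
      ⇑(∑ j, LinearMap.proj (R := ℝ) (φ := fun _ : ι => ℝ) j) :=
    LinearMap.concaveOn _ hφ.1
  have hmem : t ∈ convexHull ℝ (Set.univ.pi fun _ : ι => ({0, 1} : Set ℝ)) := by
    rw [convexHull_pi, Set.mem_univ_pi]
    intro j
    rw [convexHull_pair, segment_eq_Icc zero_le_one]
    exact ht j
  obtain ⟨y, hy, hle⟩ := (hφ.sub hlin).exists_ge_of_mem_convexHull
    (Set.pi_mono fun _ _ => by rintro x (rfl | rfl) <;> simp) hmem
  have := hv y fun j => hy j trivial
  simp only [Pi.sub_apply, LinearMap.sum_apply, LinearMap.proj_apply] at hle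
  linarith

/-! ### Spectral norm, nuclear norm and rank of matrices -/

section Matrices

variable {α β : Type*} [Fintype α] [Fintype β] [DecidableEq β]

theorem matrixSpectralNorm_le_one_iff (M : Matrix α β ℂ) :
    matrixSpectralNorm M ≤ 1 ↔ ∀ w, ‖Matrix.toEuclideanLin M w‖ ≤ ‖w‖ :=
  (Matrix.toEuclideanLin M).iSup_singularValues_le_one_iff

theorem Matrix.finrank_range_toEuclideanLin (M : Matrix α β ℂ) :
    Module.finrank ℂ (Matrix.toEuclideanLin M).range = M.rank := by
  rw [M.rank_eq_finrank_range_toLin (PiLp.basisFun 2 ℂ α) (PiLp.basisFun 2 ℂ β),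
    ← Matrix.toLpLin_eq_toLin]

/-- Past the smaller dimension the singular values vanish, so that they may be summed
up to the number of columns. -/
theorem matrixNuclearNorm_eq_sum (M : Matrix α β ℂ) {m : ℕ} (hm : Fintype.card β = m) :
    matrixNuclearNorm M = ∑ j : Fin m, (Matrix.toEuclideanLin M).singularValues j := by
  subst hm
  rw [matrixNuclearNorm, Fin.sum_univ_eq_sum_range]
  refine Finset.sum_subset (Finset.range_mono (min_le_right _ _)) fun j hj hj' => ?_
  rw [LinearMap.singularValues_eq_zero_iff_le_finrank_range, Matrix.finrank_range_toEuclideanLin]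
  simp only [Finset.mem_range, lt_min_iff, not_and_or, not_lt] at hj hj'
  rcases hj' with h | h
  · exact M.rank_le_card_height.trans h
  · omega

theorem matrixNuclearNorm_le_rank (M : Matrix α β ℂ)
    (hM : ∀ w, ‖Matrix.toEuclideanLin M w‖ ≤ ‖w‖) : matrixNuclearNorm M ≤ M.rank := by
  have hrank : M.rank ≤ min (Fintype.card α) (Fintype.card β) :=
    le_min M.rank_le_card_height M.rank_le_card_width
  calc matrixNuclearNorm M
      _ = ∑ j ∈ Finset.range M.rank, (Matrix.toEuclideanLin M).singularValues j := by
        refine (Finset.sum_subset (Finset.range_mono hrank) fun j _ hj => ?_).symm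
        rw [LinearMap.singularValues_eq_zero_iff_le_finrank_range,
          Matrix.finrank_range_toEuclideanLin]
        simpa using hj
      _ ≤ ∑ j ∈ Finset.range M.rank, (1 : ℝ) := Finset.sum_le_sum fun j _ =>
        LinearMap.singularValues_le_one hM j
      _ = M.rank := by simp

theorem Matrix.sum_star_mul_eq_trace (A B : Matrix α β ℂ) :
    ∑ i, ∑ j, star (A i j) * B i j =
      ((LinearMap.adjoint (Matrix.toEuclideanLin A)) ∘ₗ Matrix.toEuclideanLin B).trace ℂ _ := by
  rw [LinearMap.trace_adjoint_comp _ _ (EuclideanSpace.basisFun β ℂ), Finset.sum_comm]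
  refine Finset.sum_congr rfl fun j _ => ?_
  simp [PiLp.inner_apply, Matrix.toLpLin_apply, mul_comm]

/-- A block diagonal matrix is a contraction exactly if all its blocks are, since
its squared norm at a vector is the sum of those of the blocks at the components. -/
theorem Matrix.blockDiagonal_contraction_iff {S : Type*} [Fintype S] [DecidableEq S]
    (M : S → Matrix α β ℂ) :
    (∀ w, ‖Matrix.toEuclideanLin (Matrix.blockDiagonal M) w‖ ≤ ‖w‖) ↔
      ∀ s w, ‖Matrix.toEuclideanLin (M s) w‖ ≤ ‖w‖ := by
  have hval (w : EuclideanSpace ℂ (β × S)) (i : α) (s : S) :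
      Matrix.toEuclideanLin (Matrix.blockDiagonal M) w (i, s) =
        Matrix.toEuclideanLin (M s) (WithLp.toLp 2 fun j => w (j, s)) i := by
    simp [Matrix.toLpLin_apply, Matrix.mulVec, dotProduct, Fintype.sum_prod_type,
      Matrix.blockDiagonal_apply, ite_mul]
  have hnorm (w : EuclideanSpace ℂ (β × S)) :
      ‖w‖ ^ 2 = ∑ s, ‖(WithLp.toLp 2 fun j => w (j, s) : EuclideanSpace ℂ β)‖ ^ 2 := by
    simp [EuclideanSpace.norm_sq_eq, Fintype.sum_prod_type_right]
  have hnorm' (w : EuclideanSpace ℂ (β × S)) :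
      ‖Matrix.toEuclideanLin (Matrix.blockDiagonal M) w‖ ^ 2 =
        ∑ s, ‖Matrix.toEuclideanLin (M s) (WithLp.toLp 2 fun j => w (j, s))‖ ^ 2 := by
    simp only [EuclideanSpace.norm_sq_eq, Fintype.sum_prod_type_right, hval]
  constructor
  · intro h s w
    -- `W` is `w` in the block `s` and zero in the other blocks.
    let W : EuclideanSpace ℂ (β × S) := WithLp.toLp 2 fun p => if p.2 = s then w p.1 else 0
    have hs : (WithLp.toLp 2 fun j => W (j, s) : EuclideanSpace ℂ β) = w := by
      ext j; simp [W]
    have hs' (r) (hr : r ≠ s) : (WithLp.toLp 2 fun j => W (j, r) : EuclideanSpace ℂ β) = 0 := by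
      ext j; simp [W, hr]
    have h1 : ‖W‖ ^ 2 = ‖w‖ ^ 2 := by
      rw [hnorm, Finset.sum_eq_single s (fun r _ hr => by simp [hs' r hr]) (by simp), hs]
    have h2 := hnorm' W
    rw [Finset.sum_eq_single s (fun r _ hr => by simp [hs' r hr]) (by simp), hs] at h2
    refine le_of_sq_le_sq ?_ (norm_nonneg _)
    rw [← h1, ← h2]
    exact pow_le_pow_left₀ (norm_nonneg _) (h W) 2
  · intro h w
    refine le_of_sq_le_sq ?_ (norm_nonneg _)
    rw [hnorm, hnorm']
    exact Finset.sum_le_sum fun s _ => pow_le_pow_left₀ (norm_nonneg _) (h s _) 2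

end Matrices

/-! ### Tensors under a unitary transform -/

namespace PTensor

variable {d n₁ n₂ : ℕ} {n : Fin d → ℕ} {L : PTensor n₁ n₂ n → PTensor n₁ n₂ n}

theorem mem_spectralBall_iff {X : PTensor n₁ n₂ n} :
    X ∈ spectralBall L ↔ ∀ s w, ‖Matrix.toEuclideanLin (slice (L X) s) w‖ ≤ ‖w‖ :=
  (matrixSpectralNorm_le_one_iff _).trans (Matrix.blockDiagonal_contraction_iff _)

theorem innerProd_re_comm (Y X : PTensor n₁ n₂ n) : (innerProd Y X).re = (innerProd X Y).re := by
  have : innerProd Y X = star (innerProd X Y) := by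
    simp [innerProd, star_sum, mul_comm]
  rw [this]
  rfl

theorem innerProd_zero_right (Y : PTensor n₁ n₂ n) : innerProd Y 0 = 0 := by
  simp [innerProd]

theorem innerProd_re_combo (Y X Z : PTensor n₁ n₂ n) (a b : ℝ) :
    (innerProd Y (a • X + b • Z)).re = a * (innerProd Y X).re + b * (innerProd Y Z).re := by
  have : innerProd Y (a • X + b • Z) = a * innerProd Y X + b * innerProd Y Z := by
    simp only [innerProd, Finset.mul_sum, ← Finset.sum_add_distrib, Pi.add_apply, Pi.smul_apply,
      Complex.real_smul]
    exact Finset.sum_congr rfl fun _ _ => Finset.sum_congr rfl fun _ _ =>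
      Finset.sum_congr rfl fun _ _ => by ring
  simp [this]

theorem innerProd_eq_sum_trace (Y X : PTensor n₁ n₂ n) :
    innerProd Y X = ∑ s, ((LinearMap.adjoint (Matrix.toEuclideanLin (slice Y s))) ∘ₗ
      Matrix.toEuclideanLin (slice X s)).trace ℂ _ := by
  simp only [← Matrix.sum_star_mul_eq_trace]
  rw [Finset.sum_comm]
  simp only [innerProd]
  refine Finset.sum_congr rfl fun i _ => ?_
  rw [Finset.sum_comm]
  rfl

namespace IsUnitaryMap

/-- A unitary map as a linear equivalence. -/
noncomputable def toLinearEquiv (hL : IsUnitaryMap L) : PTensor n₁ n₂ n ≃ₗ[ℂ] PTensor n₁ n₂ n :=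
  LinearEquiv.ofBijective (hL.isLinear.mk' L) hL.bijective

theorem apply_toLinearEquiv_symm (hL : IsUnitaryMap L) (X : PTensor n₁ n₂ n) :
    L (hL.toLinearEquiv.symm X) = X :=
  hL.toLinearEquiv.apply_symm_apply X

theorem map_combo (hL : IsUnitaryMap L) (a b : ℝ) (X Y : PTensor n₁ n₂ n) :
    L (a • X + b • Y) = a • L X + b • L Y := by
  have h (c : ℝ) (Z : PTensor n₁ n₂ n) : c • Z = (c : ℂ) • Z := by
    ext; simp
  rw [hL.isLinear.map_add, h a, h b, hL.isLinear.map_smul, hL.isLinear.map_smul, ← h, ← h]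

theorem zero_mem_spectralBall (hL : IsUnitaryMap L) : (0 : PTensor n₁ n₂ n) ∈ spectralBall L := by
  rw [mem_spectralBall_iff]
  intro s w
  have : slice (L 0) s = 0 := by rw [hL.isLinear.map_zero]; rfl
  simp [this]

theorem multiRankL1_zero (hL : IsUnitaryMap L) : multiRankL1 L (0 : PTensor n₁ n₂ n) = 0 := by
  have (s : (k : Fin d) → Fin (n k)) : slice (L (0 : PTensor n₁ n₂ n)) s = 0 := by
    rw [hL.isLinear.map_zero]; rfl
  simp [multiRankL1, multiRank, this]

theorem convex_spectralBall (hL : IsUnitaryMap L) : Convex ℝ (spectralBall L) := by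
  intro X hX Y hY a b ha hb hab
  rw [mem_spectralBall_iff] at *
  intro s w
  have : slice (L (a • X + b • Y)) s = (a : ℂ) • slice (L X) s + (b : ℂ) • slice (L Y) s := by
    rw [hL.map_combo]; ext; simp [slice]
  rw [this, map_add, map_smul, map_smul, LinearMap.add_apply, LinearMap.smul_apply,
    LinearMap.smul_apply]
  calc _ ≤ a * ‖Matrix.toEuclideanLin (slice (L X) s) w‖
        + b * ‖Matrix.toEuclideanLin (slice (L Y) s) w‖ := by
        refine (norm_add_le _ _).trans_eq ?_
        rw [norm_smul, norm_smul, Complex.norm_of_nonneg ha, Complex.norm_of_nonneg hb]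
    _ ≤ a * ‖w‖ + b * ‖w‖ := by
        gcongr
        exacts [hX s w, hY s w]
    _ = ‖w‖ := by rw [← add_mul, hab, one_mul]

theorem nuclearNorm_le_multiRankL1 {X : PTensor n₁ n₂ n}
    (hX : X ∈ spectralBall L) : nuclearNorm L X ≤ multiRankL1 L X := by
  rw [mem_spectralBall_iff] at hX
  refine Finset.sum_le_sum fun s _ => ?_
  exact (matrixNuclearNorm_le_rank _ (hX s)).trans (le_abs_self _)

/-- The nuclear norm dominates the linear functionals given by the spectral unit ball; together
with `exists_mem_spectralBall_innerProd_eq` it is their maximum. -/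
theorem innerProd_re_le_nuclearNorm (hL : IsUnitaryMap L) {Y : PTensor n₁ n₂ n}
    (hY : Y ∈ spectralBall L) (X : PTensor n₁ n₂ n) :
    (innerProd Y X).re ≤ nuclearNorm L X := by
  rw [mem_spectralBall_iff] at hY
  rw [← hL.inner_eq, innerProd_eq_sum_trace, Complex.re_sum]
  refine Finset.sum_le_sum fun s _ => ?_
  rw [matrixNuclearNorm_eq_sum _ (finrank_euclideanSpace (𝕜 := ℂ)).symm]
  exact LinearMap.re_trace_adjoint_comp_le _ _ (hY s)

/-- The slicewise singular value decompositions of `L X`, transported back by the inverse of `L`: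
a real-linear family `A t` of tensors indexed by the singular values `t` of all slices, through
`X` itself. Its value at `1` attains the duality of the spectral and the nuclear norm. -/
theorem exists_svd_family (hL : IsUnitaryMap L) (X : PTensor n₁ n₂ n) :
    ∃ (A : (((k : Fin d) → Fin (n k)) × Fin n₂ → ℝ) →ₗ[ℝ] PTensor n₁ n₂ n)
      (σ : ((k : Fin d) → Fin (n k)) × Fin n₂ → ℝ),
      A σ = X ∧ ∑ j, σ j = nuclearNorm L X ∧
      (X ∈ spectralBall L → ∀ j, σ j ∈ Set.Icc (0 : ℝ) 1) ∧
      (∀ t, (∀ j, t j ∈ Set.Icc (0 : ℝ) 1) → A t ∈ spectralBall L) ∧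
      (∀ t, (∀ j, t j ∈ ({0, 1} : Set ℝ)) → multiRankL1 L (A t) ≤ ∑ j, t j) ∧
      (innerProd (A 1) X).re = nuclearNorm L X := by
  have hm : Module.finrank ℂ (EuclideanSpace ℂ (Fin n₂)) = n₂ := by simp
  choose D hDσ hDc hDr hDi using fun s =>
    (Matrix.toEuclideanLin (slice (L X) s)).exists_svd_family hm
  let B : (((k : Fin d) → Fin (n k)) × Fin n₂ → ℝ) →ₗ[ℝ] PTensor n₁ n₂ n :=
    { toFun := fun t i j s => Matrix.toEuclideanLin.symm (D s fun l => t (s, l)) i j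
      map_add' := fun t t' => by
        ext i j s
        have : (fun l => (t + t') (s, l)) = (fun l => t (s, l)) + fun l => t' (s, l) := rfl
        simp only [this, map_add]
        rfl
      map_smul' := fun c t => by
        ext i j s
        have h1 : (fun l => (c • t) (s, l)) = c • fun l => t (s, l) := rfl
        have h2 (M : EuclideanSpace ℂ (Fin n₂) →ₗ[ℂ] EuclideanSpace ℂ (Fin n₁)) :
            c • M = (c : ℂ) • M := by ext; simp
        simp only [h1, map_smul, h2]
        simp }
  let A := (hL.toLinearEquiv.symm.toLinearMap.restrictScalars ℝ).comp B
  have hA (t s) : Matrix.toEuclideanLin (slice (L (A t)) s) = D s fun l => t (s, l) := by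
    have : slice (L (A t)) s = Matrix.toEuclideanLin.symm (D s fun l => t (s, l)) :=
      congrArg (fun Z => slice Z s) (hL.apply_toLinearEquiv_symm (B t))
    rw [this, LinearEquiv.apply_symm_apply]
  have hnuc : nuclearNorm L X =
      ∑ s, ∑ l : Fin n₂, (Matrix.toEuclideanLin (slice (L X) s)).singularValues l :=
    Finset.sum_congr rfl fun s _ => matrixNuclearNorm_eq_sum _ (Fintype.card_fin n₂)
  let σ (p : ((k : Fin d) → Fin (n k)) × Fin n₂) : ℝ :=
    (Matrix.toEuclideanLin (slice (L X) p.1)).singularValues p.2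
  refine ⟨A, σ, ?_, ?_, fun hX p => ⟨LinearMap.singularValues_nonneg _ _, ?_⟩, fun t ht => ?_,
    fun t ht => ?_, ?_⟩
  · refine hL.bijective.1 ?_
    have (s : (k : Fin d) → Fin (n k)) := Matrix.toEuclideanLin.injective ((hA σ s).trans (hDσ s))
    ext i j s
    exact congrFun (congrFun (this s) i) j
  · rw [hnuc, Fintype.sum_prod_type]
  · rw [mem_spectralBall_iff] at hX
    exact LinearMap.singularValues_le_one (hX p.1) _
  · rw [mem_spectralBall_iff]
    intro s
    rw [hA]
    exact hDc s _ fun l => ht (s, l)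
  · rw [Fintype.sum_prod_type]
    refine Finset.sum_le_sum fun s _ => ?_
    rw [multiRank, ← Matrix.finrank_range_toEuclideanLin, hA, Nat.abs_cast]
    exact hDr s _ fun l => ht (s, l)
  · rw [← hL.inner_eq, innerProd_eq_sum_trace, Complex.re_sum, hnuc]
    refine Finset.sum_congr rfl fun s _ => ?_
    rw [hA]
    exact hDi s

theorem exists_mem_spectralBall_innerProd_eq (hL : IsUnitaryMap L) (X : PTensor n₁ n₂ n) :
    ∃ Y ∈ spectralBall L, (innerProd Y X).re = nuclearNorm L X := by
  obtain ⟨A, -, -, -, -, hA, -, h1⟩ := hL.exists_svd_family X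
  exact ⟨A 1, hA 1 fun _ => ⟨zero_le_one, le_rfl⟩, h1⟩

theorem convexOn_nuclearNorm (hL : IsUnitaryMap L) :
    ConvexOn ℝ (spectralBall L) (nuclearNorm L) := by
  refine ⟨hL.convex_spectralBall, fun X _ Z _ a b ha hb _ => ?_⟩
  obtain ⟨Y, hY, hYX⟩ := hL.exists_mem_spectralBall_innerProd_eq (a • X + b • Z)
  rw [← hYX, innerProd_re_combo, smul_eq_mul, smul_eq_mul]
  gcongr
  exacts [hL.innerProd_re_le_nuclearNorm hY X, hL.innerProd_re_le_nuclearNorm hY Z]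

/-- The nuclear norm is the largest convex minorant: on the cube of all families of singular
values it is the sum of the coordinates, which bounds the multi-rank at every vertex. -/
theorem le_nuclearNorm_of_convexOn (hL : IsUnitaryMap L) {h : PTensor n₁ n₂ n → ℝ}
    (hc : ConvexOn ℝ (spectralBall L) h) (hle : ∀ X ∈ spectralBall L, h X ≤ multiRankL1 L X)
    {X : PTensor n₁ n₂ n} (hX : X ∈ spectralBall L) : h X ≤ nuclearNorm L X := by
  obtain ⟨A, σ, hσ, hsum, hσ1, hA, hr, -⟩ := hL.exists_svd_family X
  have hφ : ConvexOn ℝ (Set.univ.pi fun _ => Set.Icc (0 : ℝ) 1) (h ∘ A) :=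
    (hc.comp_linearMap A).subset (fun t ht => hA t fun j => ht j trivial)
      (convex_pi fun _ _ => convex_Icc 0 1)
  rw [← hsum]
  conv_lhs => rw [← hσ]
  refine hφ.le_sum_of_le_sum_vertices (fun t ht => ?_) (hσ1 hX)
  refine (hle _ (hA t fun j => ?_)).trans (hr t ht)
  rcases ht j with h | h <;> simp [show t j = _ from h]

theorem isConvexEnvelopeOn_nuclearNorm (hL : IsUnitaryMap L) :
    IsConvexEnvelopeOn (spectralBall L) (multiRankL1 L) (nuclearNorm L) :=
  ⟨hL.convexOn_nuclearNorm, fun _ hX => nuclearNorm_le_multiRankL1 hX,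
    fun _ hc hle _ hX => hL.le_nuclearNorm_of_convexOn hc hle hX⟩

/-! ### The conjugate and the biconjugate -/

theorem conjugateOn_nonneg (hL : IsUnitaryMap L) (Y : PTensor n₁ n₂ n) :
    0 ≤ conjugateOn (spectralBall L) (fun X => (multiRankL1 L X : EReal)) Y := by
  refine le_trans ?_ (le_iSup₂ (0 : PTensor n₁ n₂ n) hL.zero_mem_spectralBall)
  simp [innerProd_zero_right, hL.multiRankL1_zero]

/-- On the spectral unit ball `Re ⟨Y, X⟩ ≤ ‖X‖_{*,L}`, which the multi-rank dominates. -/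
theorem conjugateOn_nonpos (hL : IsUnitaryMap L) {Y : PTensor n₁ n₂ n}
    (hY : Y ∈ spectralBall L) :
    conjugateOn (spectralBall L) (fun X => (multiRankL1 L X : EReal)) Y ≤ 0 := by
  refine iSup₂_le fun X hX => ?_
  rw [← EReal.coe_sub, ← EReal.coe_zero, EReal.coe_le_coe_iff, sub_nonpos]
  exact (hL.innerProd_re_le_nuclearNorm hY X).trans (nuclearNorm_le_multiRankL1 hX)

theorem biconjugateOn_eq_nuclearNorm (hL : IsUnitaryMap L) {Z : PTensor n₁ n₂ n}
    (hZ : Z ∈ spectralBall L) :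
    biconjugateOn (spectralBall L) (multiRankL1 L) Z = ((nuclearNorm L Z : ℝ) : EReal) := by
  refine le_antisymm (iSup₂_le fun Y _ => ?_) ?_
  · -- A finite conjugate at `Y` makes `X ↦ Re ⟨Y, X⟩ - c` an affine minorant of the multi-rank.
    rcases eq_or_ne (conjugateOn (spectralBall L) (fun X => (multiRankL1 L X : EReal)) Y) ⊤
      with htop | htop
    · rw [htop]
      simp
    · obtain ⟨c, hc⟩ : ∃ c : ℝ, (c : EReal) =
          conjugateOn (spectralBall L) (fun X => (multiRankL1 L X : EReal)) Y :=
        ⟨_, EReal.coe_toReal htop (ne_bot_of_le_ne_bot EReal.zero_ne_bot (hL.conjugateOn_nonneg Y))⟩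
      rw [← hc, ← EReal.coe_sub, EReal.coe_le_coe_iff, innerProd_re_comm]
      refine hL.le_nuclearNorm_of_convexOn (h := fun X => (innerProd Y X).re - c)
        ⟨hL.convex_spectralBall, fun X _ W _ a b _ _ hab => le_of_eq ?_⟩ (fun X hX => ?_) hZ
      · simp only [innerProd_re_combo, smul_eq_mul]
        linear_combination c * hab
      · have h : (((innerProd Y X).re - multiRankL1 L X : ℝ) : EReal) ≤ c := by
          rw [hc, EReal.coe_sub]
          exact le_iSup₂ (f := fun X (_ : X ∈ spectralBall L) =>
            (((innerProd Y X).re : ℝ) : EReal) - (multiRankL1 L X : EReal)) X hX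
        have := EReal.coe_le_coe_iff.1 h
        linarith
  · -- At the `Y` that attains the duality for `Z` the conjugate vanishes.
    obtain ⟨Y, hY, hYZ⟩ := hL.exists_mem_spectralBall_innerProd_eq Z
    have h0 := le_antisymm (hL.conjugateOn_nonpos hY) (hL.conjugateOn_nonneg Y)
    refine le_trans ?_ (le_iSup₂ Y (Set.mem_univ Y))
    rw [h0, sub_zero, innerProd_re_comm, hYZ]

end IsUnitaryMap

end PTensor

theorem mainTheorem1 {d : ℕ} (n₁ n₂ : ℕ) (n : Fin d → ℕ)
    (T : (k : Fin d) → Matrix (Fin (n k)) (Fin (n k)) ℂ)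
    (hL : PTensor.IsUnitaryMap
      (PTensor.transform T : PTensor n₁ n₂ n → PTensor n₁ n₂ n)) :
    IsConvexEnvelopeOn
        (PTensor.spectralBall (PTensor.transform T : PTensor n₁ n₂ n → PTensor n₁ n₂ n))
        (PTensor.multiRankL1 (PTensor.transform T))
        (PTensor.nuclearNorm (PTensor.transform T)) ∧
      ∀ Z ∈ PTensor.spectralBall (PTensor.transform T : PTensor n₁ n₂ n → PTensor n₁ n₂ n),
        PTensor.biconjugateOn (PTensor.spectralBall (PTensor.transform T))
            (PTensor.multiRankL1 (PTensor.transform T)) Z =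
          ((PTensor.nuclearNorm (PTensor.transform T) Z : ℝ) : EReal) :=
  ⟨hL.isConvexEnvelopeOn_nuclearNorm, fun _ hZ => hL.biconjugateOn_eq_nuclearNorm hZ⟩
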